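/- All digraphs are finite; parallel arcs and loops are allowed. A digraph $G=(V,A)$ is Eulerian if it is connected and every vertex has equal in- and out-degree (loops counted). Write $\deg_G(u,v)$ for the number of arcs from $u$ to $v$, $\deg_G^+(v)$ for the out-degree of $v$ (loops included), and $\overline{G}$ for $G$ with its loops removed. Chip-firing with sink $r\in V$: a configuration is a map $c:V\setminus\{r\}\to\mathbb N$. A vertex $v\ne r$ is firable in $c$ if $c(v)\ge \deg_G^+(v)$ and $\deg_G^+(v)-\deg_G(v,v)\ge 1$; firing it removes $\deg_G^+(v)$ chips from $v$ and then adds $\deg_G(v,u)$ chips to every $u\neq r$. A configuration is stable if no vertex is firable, and $c^\circ$ denotes the stable configuration reached from $c$ by legal firings. A stable configuration $c$ is recurrent if for every configuration $d$ there is a configuration $d'$ with $c=(d+d')^\circ$. Let $\mathrm{sum}_{G,r}(c)=\deg_G^+(r)+\sum_{v\ne r}c(v)$, let $\kappa(\overline G)$ be the minimum of $\mathrm{sum}_{\overline G,r}(c)$ over the recurrent configurations $c$ of $\overline G$ with sink $r$, and let $$\mathcal T_G(y)=\sum_{c}y^{\,\mathrm{sum}_{G,r}(c)-\kappa(\overline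 G)},$$ the sum being over the recurrent configurations $c$ of $G$ with sink $r$. For Eulerian $G$, neither $\kappa(\overline G)$ nor $\mathcal T_G(y)$ depends on the choice of $r$. For $U\subseteq V$ let $G_{/U}$ be the digraph obtained by replacing all vertices of $U$ by one new vertex and keeping all arcs (arcs inside $U$ become loops). Proposition. Let $G=(V,A)$ be an Eulerian digraph, possibly with loops, with at least two vertices. Let $s$ be a vertex of $G$ and let $N$ be the set of all out-neighbours of $s$ other than $s$ itself. Then $$\mathcal T_G(y)=\sum_{\emptyset\neq W\subseteq N}(-1)^{|W|+1}\,y^{\kappa(\overline{G_{/(W\cup\{s\})}})-\kappa(\overline G)-\deg_G(s,W)}\,\frac{1}{(1-y)^{|W|}}\prod_{v\in W}\bigl(1-y^{\deg_G(s,v)}\bigr)\,\mathcal T_{G_{/(W\cup\{s\})}}(y)$$ as an identity of rational functions in $y$, where $\deg_G(s,W)$ is the number of arcs of $G$ from $s$ to a vertex of $W$. The identity holds whichever sinks are used to compute the polynomials and the numbers $\kappa$ on the two sides. -/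

import Mathlib

open scoped Finset

/-- A directed multigraph with vertex type `V` and arc type `A`; loops and parallel arcs are
allowed. -/
structure MultiDigraph (V A : Type*) where
  /-- the vertex an arc starts from -/
  tail : A → V
  /-- the vertex an arc points to -/
  head : A → V

namespace MultiDigraph

section Basic

variable {V A : Type*} [Fintype V] [DecidableEq V] [Fintype A]

/-- `deg(u, v)`: the number of arcs from `u` to `v`. -/
def numArcs (G : MultiDigraph V A) (u v : V) : ℕ :=
  #{e : A | G.tail e = u ∧ G.head e = v}

/-- `deg(u, W)`: the number of arcs from `u` to a vertex of `W`. -/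
def numArcsTo (G : MultiDigraph V A) (u : V) (W : Finset V) : ℕ :=
  #{e : A | G.tail e = u ∧ G.head e ∈ W}

/-- The out-degree of `v`, loops included. -/
def outDegree (G : MultiDigraph V A) (v : V) : ℕ :=
  #{e : A | G.tail e = v}

/-- The in-degree of `v`, loops included. -/
def inDegree (G : MultiDigraph V A) (v : V) : ℕ :=
  #{e : A | G.head e = v}

/-- The out-neighbours of `s`; `s` itself is never counted, even if it carries a loop. -/
def outNeighbors (G : MultiDigraph V A) (s : V) : Finset V :=
  {v : V | v ≠ s ∧ ∃ e : A, G.tail e = s ∧ G.head e = v}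

/-- `G` is connected (as an undirected graph). -/
def IsConnected (G : MultiDigraph V A) : Prop :=
  Nonempty V ∧
    ∀ u v : V, Relation.EqvGen (fun a b => ∃ e : A, G.tail e = a ∧ G.head e = b) u v

/-- `G` is Eulerian: connected, with equal in- and out-degree at every vertex. -/
def IsEulerian (G : MultiDigraph V A) : Prop :=
  G.IsConnected ∧ ∀ v : V, G.inDegree v = G.outDegree v

/-- `G` with all its loops removed. -/
def deleteLoops (G : MultiDigraph V A) :
    MultiDigraph V {e : A // G.tail e ≠ G.head e} where
  tail e := G.tail e.1
  head e := G.head e.1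

/-- The map sending every vertex of `U` to the new vertex `none` and fixing the other vertices. -/
def contractMap (U : Finset V) (v : V) : Option {v : V // v ∉ U} :=
  if h : v ∈ U then none else some ⟨v, h⟩

/-- Vertex contraction `G_{/U}`: the vertices of `U` are replaced by one new vertex `none`, and all
arcs are kept (those inside `U` become loops at the new vertex). -/
def contract (G : MultiDigraph V A) (U : Finset V) :
    MultiDigraph (Option {v : V // v ∉ U}) A where
  tail e := contractMap U (G.tail e)
  head e := contractMap U (G.head e)

end Basic

/-! ### The chip-firing game with sink `s` -/

section Game

variable {V A : Type*} [Fintype V] [DecidableEq V] [Fintype A]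

/-- A configuration with sink `s`: a number of chips on every vertex other than `s`. -/
abbrev Config (s : V) : Type _ := {v : V // v ≠ s} → ℕ

/-- `v ≠ s` is firable in `c` if it has at least as many chips as out-going arcs, and not all of
its out-going arcs are loops. -/
def Firable (G : MultiDigraph V A) {s : V} (c : Config s) (v : {v : V // v ≠ s}) : Prop :=
  G.outDegree v ≤ c v ∧ G.numArcs v v < G.outDegree v

/-- The result of firing `v` (meant for firable `v`): `v` loses one chip for each of its out-going
arcs, and every vertex receives one chip for each arc from `v` to it; chips sent to `s` vanish. -/
def fire (G : MultiDigraph V A) {s : V} (c : Config s) (v : {v : V // v ≠ s}) : Config s :=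
  fun u => (c u - if u = v then G.outDegree v else 0) + G.numArcs v u

/-- One legal firing leads from `c` to `c'`. -/
def Step (G : MultiDigraph V A) {s : V} (c c' : Config s) : Prop :=
  ∃ v, G.Firable c v ∧ c' = G.fire c v

/-- No vertex other than the sink is firable. -/
def Stable (G : MultiDigraph V A) {s : V} (c : Config s) : Prop :=
  ∀ v, ¬ G.Firable c v

/-- `c° = c'`: the configuration `c'` is stable and is reached from `c` by legal firings. -/
def StabilizesTo (G : MultiDigraph V A) {s : V} (c c' : Config s) : Prop :=
  Relation.ReflTransGen G.Step c c' ∧ G.Stable c'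

/-- A stable configuration `c` is recurrent if for every configuration `d` there is a configuration
`d'` with `(d + d')° = c`. -/
def Recurrent (G : MultiDigraph V A) (s : V) (c : Config s) : Prop :=
  G.Stable c ∧ ∀ d : Config s, ∃ d' : Config s, G.StabilizesTo (d + d') c

/-- `deg⁺(s) + ∑_{v ≠ s} c(v)`. -/
def confSum (G : MultiDigraph V A) (s : V) (c : Config s) : ℕ :=
  G.outDegree s + ∑ v, c v

/-- `κ(G)`, computed with sink `s`: the minimum of `confSum` over the recurrent configurations of
the loopless digraph `G.deleteLoops`. -/
noncomputable def kappa (G : MultiDigraph V A) (s : V) : ℕ :=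
  sInf {n | ∃ c : Config s, G.deleteLoops.Recurrent s c ∧ n = G.deleteLoops.confSum s c}

/-- The level of a (recurrent) configuration of `G`. -/
noncomputable def level (G : MultiDigraph V A) (s : V) (c : Config s) : ℤ :=
  (G.confSum s c : ℤ) - (G.kappa s : ℤ)

/-- `T_G(y)`, computed with sink `s`: the generating function `∑ y ^ level(c)` over the recurrent
configurations `c` of `G`, as an element of the field `ℚ(y)`, where `y = RatFunc.X`. -/
noncomputable def tutte (G : MultiDigraph V A) (s : V) : RatFunc ℚ :=
  ∑ᶠ c ∈ {c : Config s | G.Recurrent s c}, (RatFunc.X : RatFunc ℚ) ^ G.level s c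

end Game

end MultiDigraph

/-!
The exponents `κ` cancel: up to the power `X ^ (-κ)` the polynomial of an Eulerian digraph is the
generating function `P(G, r) = ∑ X ^ confSum c` over the recurrent configurations `c` with sink `r`,
so the identity only concerns these generating functions.

By Dhar's criterion (`IsEulerian.recurrent_iff`), a stable configuration of an Eulerian digraph is
recurrent exactly if it satisfies the burning condition `IsBurnable`. That condition survives every
firing, and by a minimum principle for the firing vector each class of the reduced Laplacian lattice
contains at most one stable configuration that satisfies it (`IsEulerian.eq_of_isBurnable`). It
contains one, since the reduced Laplacian is invertible over `ℚ`: its adjugate supplies arbitrarily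
large configurations in each class and a potential that makes every game terminate.

`P(G, r)` does not depend on `r` (`IsEulerian.sum_pow_confSum_eq`). Fix a number `N` of chips and
extend a recurrent configuration `c` to the sink by putting the other `N - ∑ c` chips there. This
matches the recurrent configurations with sink `r` with the classes of degree `N` of the full
Laplacian. The sink then holds at least `deg⁺(r)` chips, that is `confSum c ≤ N`, exactly if the
class has no representative that is stable at every vertex (`IsEulerian.exists_outDegree_le`), and
this property of the class does not mention `r`. So the number of recurrent configurations with
`confSum ≤ N` is the same for all sinks.

It remains to compute with the sink `s` on the left and the new vertex on the right. After `s` has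
fired, at least one vertex of a recurrent configuration `c` becomes unstable (`ignited`), so
inclusion–exclusion over the nonempty sets `W` of such vertices gives
`IsEulerian.sum_recurrentRel`. A configuration for which all of `W` is ignited is recurrent exactly
if its restriction to the other vertices is recurrent for the contraction of `W ∪ {s}`, while each
`v ∈ W` may hold any number of chips in `[deg⁺(v) - deg(s, v), deg⁺(v))`
(`IsEulerian.sum_ignited`). The geometric sums over these intervals are the factors
`(1 - X ^ deg(s, v)) / (1 - X)`.
-/

set_option linter.unusedSectionVars false

namespace MultiDigraph

section Laplacian

variable {V A : Type*} [DecidableEq V] [Fintype A]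

/-! ### Degrees and the Laplacian -/

theorem sum_inDegree (G : MultiDigraph V A) (S : Finset V) :
    ∑ v ∈ S, G.inDegree v = #{e : A | G.head e ∈ S} := by
  unfold inDegree
  rw [Finset.card_eq_sum_card_fiberwise (s := {e : A | G.head e ∈ S}) (f := G.head) (t := S)
    (by intro e; simp)]
  refine Finset.sum_congr rfl fun v hv => ?_
  rw [Finset.filter_filter]
  congr 1
  ext e
  simp only [Finset.mem_filter, Finset.mem_univ, true_and]
  exact ⟨fun h => ⟨h ▸ hv, h⟩, fun h => h.2⟩

theorem sum_outDegree (G : MultiDigraph V A) (S : Finset V) :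
    ∑ v ∈ S, G.outDegree v = #{e : A | G.tail e ∈ S} := by
  unfold outDegree
  rw [Finset.card_eq_sum_card_fiberwise (s := {e : A | G.tail e ∈ S}) (f := G.tail) (t := S)
    (by intro e; simp)]
  refine Finset.sum_congr rfl fun v hv => ?_
  rw [Finset.filter_filter]
  congr 1
  ext e
  simp only [Finset.mem_filter, Finset.mem_univ, true_and]
  exact ⟨fun h => ⟨h ▸ hv, h⟩, fun h => h.2⟩

theorem numArcs_pos_iff (G : MultiDigraph V A) (u v : V) :
    0 < G.numArcs u v ↔ ∃ e, G.tail e = u ∧ G.head e = v := by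
  simp [numArcs, Finset.card_pos, Finset.filter_nonempty_iff]

variable [Fintype V]

theorem sum_numArcs_right (G : MultiDigraph V A) (u : V) :
    ∑ v, G.numArcs u v = G.outDegree u := by
  unfold numArcs outDegree
  rw [Finset.card_eq_sum_card_fiberwise (f := G.head) (t := Finset.univ) (by simp)]
  simp [Finset.filter_filter]

theorem sum_numArcs_left (G : MultiDigraph V A) (v : V) :
    ∑ u, G.numArcs u v = G.inDegree v := by
  unfold numArcs inDegree
  rw [Finset.card_eq_sum_card_fiberwise (f := G.tail) (t := Finset.univ) (by simp)]
  simp [Finset.filter_filter, and_comm]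

theorem IsEulerian.sum_numArcs_left {G : MultiDigraph V A} (hG : G.IsEulerian) (v : V) :
    ∑ u, G.numArcs u v = G.outDegree v := by
  rw [G.sum_numArcs_left, hG.2]

/-- In an Eulerian digraph some arc enters every proper nonempty vertex set: as many arcs leave the
set as enter it, so otherwise the set would be a union of connected components. -/
theorem IsEulerian.exists_arc_into {G : MultiDigraph V A} (hG : G.IsEulerian) {S : Finset V}
    (hS : S.Nonempty) {r : V} (hr : r ∉ S) : ∃ u ∉ S, ∃ v ∈ S, 0 < G.numArcs u v := by
  by_contra! H
  have hsub : ({e | G.head e ∈ S} : Finset A) ⊆ ({e | G.tail e ∈ S} : Finset A) := by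
    intro e
    simp only [Finset.mem_filter, Finset.mem_univ, true_and]
    intro he
    by_contra ht
    have h0 := H _ ht _ he
    have h1 := (G.numArcs_pos_iff (G.tail e) (G.head e)).2 ⟨e, rfl, rfl⟩
    omega
  have hcard : #{e : A | G.tail e ∈ S} ≤ #{e : A | G.head e ∈ S} := by
    rw [← G.sum_inDegree, ← G.sum_outDegree]
    exact (Finset.sum_congr rfl fun v _ => (hG.2 v).symm).le
  have heq := Finset.eq_of_subset_of_card_le hsub hcard
  have key : ∀ u v : V, Relation.EqvGen (fun a b => ∃ e : A, G.tail e = a ∧ G.head e = b) u v →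
      (u ∈ S ↔ v ∈ S) := by
    intro u v h
    induction h with
    | rel a b h =>
      obtain ⟨e, rfl, rfl⟩ := h
      have : e ∈ ({e : A | G.head e ∈ S} : Finset A) ↔ e ∈ ({e : A | G.tail e ∈ S} : Finset A) := by
        rw [heq]
      simpa using this.symm
    | refl => rfl
    | symm _ _ _ ih => exact ih.symm
    | trans _ _ _ _ _ ih1 ih2 => exact ih1.trans ih2
  obtain ⟨v, hv⟩ := hS
  exact hr ((key v r (hG.1.2 v r)).1 hv)

theorem IsEulerian.numArcs_self_lt {G : MultiDigraph V A} (hG : G.IsEulerian) {v r : V}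
    (h : v ≠ r) : G.numArcs v v < G.outDegree v := by
  obtain ⟨u, hu, w, hw, hpos⟩ := hG.exists_arc_into (S := {v}) (by simp) (r := r)
    (by simpa using h.symm)
  obtain rfl : w = v := by simpa using hw
  rw [← hG.sum_numArcs_left w]
  have huv : u ≠ w := by simpa using hu
  calc G.numArcs w w < G.numArcs u w + G.numArcs w w := by omega
    _ = ∑ a ∈ {u, w}, G.numArcs a w :=
      (Finset.sum_pair (f := fun a => G.numArcs a w) huv).symm
    _ ≤ _ := Finset.sum_le_univ_sum_of_nonneg (by simp)

theorem IsEulerian.stable_iff {G : MultiDigraph V A} (hG : G.IsEulerian) {r : V} (c : Config r) :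
    G.Stable c ↔ ∀ v, c v < G.outDegree v := by
  refine forall_congr' fun v => ?_
  have := hG.numArcs_self_lt v.2
  simp only [Firable, this, and_true, not_le]

/-- The change of the number of chips on `v` when every vertex `u` is fired `x u` times. -/
def netChips (G : MultiDigraph V A) (x : V → ℤ) (v : V) : ℤ :=
  ∑ u, x u * G.numArcs u v - x v * G.outDegree v

theorem netChips_add (G : MultiDigraph V A) (x y : V → ℤ) (v : V) :
    G.netChips (x + y) v = G.netChips x v + G.netChips y v := by
  simp only [netChips, Pi.add_apply, add_mul, Finset.sum_add_distrib]
  ring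

theorem netChips_smul (G : MultiDigraph V A) (k : ℤ) (x : V → ℤ) (v : V) :
    G.netChips (k • x) v = k * G.netChips x v := by
  simp only [netChips, Pi.smul_apply, smul_eq_mul, mul_assoc, mul_sub, Finset.mul_sum]

theorem netChips_neg (G : MultiDigraph V A) (x : V → ℤ) (v : V) :
    G.netChips (-x) v = - G.netChips x v := by
  simpa using G.netChips_smul (-1) x v

theorem netChips_zero (G : MultiDigraph V A) (v : V) : G.netChips 0 v = 0 := by
  simp [netChips]

theorem netChips_single (G : MultiDigraph V A) (w v : V) :
    G.netChips (Pi.single w 1) v = G.numArcs w v - if v = w then (G.outDegree w : ℤ) else 0 := by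
  rcases eq_or_ne v w with rfl | h
  · simp [netChips, Pi.single_apply]
  · simp [netChips, Pi.single_apply, h]

theorem sum_netChips (G : MultiDigraph V A) (x : V → ℤ) : ∑ v, G.netChips x v = 0 := by
  simp only [netChips, Finset.sum_sub_distrib]
  rw [Finset.sum_comm, sub_eq_zero]
  refine Finset.sum_congr rfl fun u _ => ?_
  rw [← Finset.mul_sum, ← G.sum_numArcs_right]
  push_cast
  rfl

/-- Firing all vertices equally often changes nothing, so only the differences `x u - x v`
matter. -/
theorem IsEulerian.netChips_eq {G : MultiDigraph V A} (hG : G.IsEulerian) (x : V → ℤ) (v : V) :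
    G.netChips x v = ∑ u, (x u - x v) * G.numArcs u v := by
  simp only [netChips, sub_mul, Finset.sum_sub_distrib, ← Finset.mul_sum]
  rw [← hG.sum_numArcs_left v]
  push_cast
  rfl

/-- A configuration in which `v` holds one chip per arc coming from the set of least fired vertices
makes `v` unstable after firing according to `x`. -/
theorem IsEulerian.outDegree_le_of_argmin {G : MultiDigraph V A} (hG : G.IsEulerian) {x : V → ℤ}
    {S : Finset V} {v : V} (hS : ∀ u, u ∉ S → x v < x u) (hS' : ∀ u ∈ S, x u = x v)
    {d : ℤ} (hd : (∑ u ∈ S, G.numArcs u v : ℕ) ≤ d) :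
    (G.outDegree v : ℤ) ≤ d + G.netChips x v := by
  have h1 : ((∑ u ∈ Sᶜ, G.numArcs u v : ℕ) : ℤ) ≤ G.netChips x v := by
    rw [hG.netChips_eq, ← Finset.sum_add_sum_compl S]
    have : ∑ u ∈ S, (x u - x v) * (G.numArcs u v : ℤ) = 0 :=
      Finset.sum_eq_zero fun u hu => by simp [hS' u hu]
    rw [this, zero_add]
    push_cast
    refine Finset.sum_le_sum fun u hu => ?_
    have := hS u (by simpa using hu)
    exact le_mul_of_one_le_left (by positivity) (by omega)
  rw [← hG.sum_numArcs_left v, ← Finset.sum_add_sum_compl S]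
  push_cast at *
  omega

/-- A vector with vanishing net flow off the sink is nowhere above its value at the sink. -/
theorem IsEulerian.le_of_netChips_eq_zero {G : MultiDigraph V A} (hG : G.IsEulerian) {r : V}
    {x : V → ℤ} (hx : ∀ v, v ≠ r → G.netChips x v = 0) (v : V) : x v ≤ x r := by
  obtain ⟨m, -, hm⟩ := Finset.exists_max_image Finset.univ x ⟨r, Finset.mem_univ r⟩
  by_contra! hlt
  have hrm : x r < x m := hlt.trans_le (hm v (Finset.mem_univ v))
  obtain ⟨u, hu, w, hw, hpos⟩ := hG.exists_arc_into (S := {w | x w = x m}) ⟨m, by simp⟩ (r := r)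
    (by simp; omega)
  simp only [Finset.mem_filter, Finset.mem_univ, true_and] at hu hw
  have h0 := hx w (by rintro rfl; omega)
  rw [hG.netChips_eq] at h0
  have hle : ∀ a ∈ Finset.univ, (x a - x w) * (G.numArcs a w : ℤ) ≤ 0 := fun a _ =>
    mul_nonpos_of_nonpos_of_nonneg (by have := hm a (Finset.mem_univ a); omega) (by positivity)
  have h1 := (Finset.sum_eq_zero_iff_of_nonpos hle).1 h0 u (Finset.mem_univ u)
  rcases mul_eq_zero.1 h1 with h | h <;> omega

/-- The Laplacian of `G` with the row and the column of the sink `r` removed. -/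
def reducedLaplacian (G : MultiDigraph V A) (r : V) : Matrix {v : V // v ≠ r} {v : V // v ≠ r} ℤ :=
  fun u v => (if u = v then (G.outDegree u : ℤ) else 0) - G.numArcs u v

theorem sum_subtype_ne {M : Type*} [AddCommMonoid M] (r : V) (f : V → M) (hr : f r = 0) :
    ∑ v : {v : V // v ≠ r}, f v = ∑ v, f v := by
  rw [← Finset.sum_subtype (Finset.univ.erase r) (by simp) f,
    ← Finset.add_sum_erase _ _ (Finset.mem_univ r), hr, zero_add]

theorem netChips_extend (G : MultiDigraph V A) {r : V} (x : {v : V // v ≠ r} → ℤ)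
    (v : {v : V // v ≠ r}) :
    G.netChips (fun u => if h : u ≠ r then x ⟨u, h⟩ else 0) v =
      - Matrix.vecMul x (G.reducedLaplacian r) v := by
  simp only [netChips, Matrix.vecMul, dotProduct, reducedLaplacian]
  rw [← sum_subtype_ne r _ (by simp)]
  simp only [ne_eq, dite_eq_ite, v.2, not_false_eq_true, Subtype.coe_eta, mul_sub, mul_ite,
    mul_zero, Finset.sum_sub_distrib, Finset.sum_ite_eq', Finset.mem_univ, if_true,
    neg_sub, sub_left_inj]
  exact Finset.sum_congr rfl fun u _ => by simp [u.2]

theorem IsEulerian.det_reducedLaplacian_ne_zero {G : MultiDigraph V A} (hG : G.IsEulerian)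
    (r : V) : (G.reducedLaplacian r).det ≠ 0 := by
  rw [Ne, ← Matrix.exists_vecMul_eq_zero_iff]
  rintro ⟨x, hx0, hx⟩
  set y : V → ℤ := fun u => if h : u ≠ r then x ⟨u, h⟩ else 0 with hy
  have hy0 : ∀ v, v ≠ r → G.netChips y v = 0 := fun v hv => by
    have := G.netChips_extend x ⟨v, hv⟩
    rwa [hx, Pi.zero_apply, neg_zero] at this
  have h1 := hG.le_of_netChips_eq_zero hy0
  have h2 := hG.le_of_netChips_eq_zero (x := -y) (r := r)
    (fun v hv => by rw [netChips_neg, hy0 v hv, neg_zero])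
  apply hx0
  ext v
  have h3 := h1 v
  have h4 := h2 v
  simp only [hy, Pi.neg_apply, ne_eq, v.2, not_false_eq_true, dite_true, not_true_eq_false,
    dite_false, Subtype.coe_eta, neg_zero] at h3 h4
  simp only [Pi.zero_apply]
  omega

/-- Some firing vector adds the same positive number of chips to each vertex off the sink. -/
theorem IsEulerian.exists_netChips_pos {G : MultiDigraph V A} (hG : G.IsEulerian) (r : V) :
    ∃ (x : V → ℤ) (M : ℤ), 0 < M ∧ ∀ v, v ≠ r → G.netChips x v = M := by
  have hdet := hG.det_reducedLaplacian_ne_zero r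
  set L := G.reducedLaplacian r
  refine ⟨_, L.det ^ 2, by positivity, fun v hv =>
    (G.netChips_extend (Matrix.vecMul (fun _ => -L.det) L.adjugate) ⟨v, hv⟩).trans ?_⟩
  rw [Matrix.vecMul_vecMul, Matrix.adjugate_mul]
  simp [L, sq]

/-- A potential for the chip-firing game: a weighting of the vertices for which each firing off
the sink lowers the total weight of the chips. -/
theorem IsEulerian.exists_potential {G : MultiDigraph V A} (hG : G.IsEulerian) (r : V) :
    ∃ h : {v : V // v ≠ r} → ℕ, ∀ u : {v : V // v ≠ r},
      ∑ v : {v : V // v ≠ r}, G.numArcs u v * h v < G.outDegree u * h u := by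
  have hdet := hG.det_reducedLaplacian_ne_zero r
  set L := G.reducedLaplacian r with hL
  obtain ⟨g, hg⟩ : ∃ g : {v : V // v ≠ r} → ℤ, ∀ u, 0 < L.mulVec g u := by
    refine ⟨Matrix.mulVec L.adjugate (fun _ => L.det), fun u => ?_⟩
    rw [Matrix.mulVec_mulVec, Matrix.mul_adjugate]
    simp only [Matrix.smul_mulVec, Matrix.one_mulVec, Pi.smul_apply, smul_eq_mul]
    exact mul_self_pos.2 hdet
  have hg' : ∀ u : {v : V // v ≠ r}, ∑ v : {v : V // v ≠ r}, (G.numArcs u v : ℤ) * g v <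
      G.outDegree u * g u := by
    intro u
    have := hg u
    simp only [Matrix.mulVec, dotProduct, hL, reducedLaplacian, sub_mul, ite_mul, zero_mul,
      Finset.sum_sub_distrib, Finset.sum_ite_eq, Finset.mem_univ, if_true] at this
    omega
  -- at a vertex where `g` is least and negative, the inequality `hg'` would fail
  have hpos : ∀ u, 0 ≤ g u := by
    intro u
    obtain ⟨m, -, hm⟩ := Finset.exists_min_image Finset.univ g ⟨u, Finset.mem_univ u⟩
    by_contra! hlt
    have hm0 : g m < 0 := (hm u (Finset.mem_univ u)).trans_lt hlt
    have h1 := hg' m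
    have h2 : ∑ v : {v : V // v ≠ r}, (G.numArcs m v : ℤ) * g m ≤
        ∑ v : {v : V // v ≠ r}, (G.numArcs m v : ℤ) * g v :=
      Finset.sum_le_sum fun v hv => mul_le_mul_of_nonneg_left (hm v hv) (by positivity)
    rw [← Finset.sum_mul] at h2
    have h3 : ∑ v : {v : V // v ≠ r}, (G.numArcs m v : ℤ) ≤ G.outDegree m := by
      rw [← G.sum_numArcs_right, ← Finset.sum_subtype (Finset.univ.erase r) (by simp)
        (fun v => (G.numArcs m v : ℤ))]
      push_cast
      exact Finset.sum_le_univ_sum_of_nonneg (by simp)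
    nlinarith
  lift g to {v : V // v ≠ r} → ℕ using hpos
  refine ⟨g, fun u => ?_⟩
  have := hg' u
  beta_reduce at this
  exact_mod_cast this

end Laplacian

section Game

variable {V A : Type*} [Fintype V] [DecidableEq V] [Fintype A]

/-! ### Recurrent configurations of Eulerian digraphs -/

/-- Dhar's burning condition: each nonempty vertex set `S` off the sink has a vertex `v` with at
least as many chips as there are arcs from `S` to `v`. In an Eulerian digraph this says that, once
all vertices outside `S` have fired, some vertex of `S` is ready to fire. -/
def IsBurnable (G : MultiDigraph V A) {r : V} (c : Config r) : Prop :=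
  ∀ S : Finset {v : V // v ≠ r}, S.Nonempty → ∃ v ∈ S, ∑ u ∈ S, G.numArcs u v ≤ c v

theorem IsEulerian.sum_numArcs_le {G : MultiDigraph V A} (hG : G.IsEulerian) {r : V}
    (S : Finset {v : V // v ≠ r}) (v : V) : ∑ u ∈ S, G.numArcs u v ≤ G.outDegree v := by
  rw [← hG.sum_numArcs_left v]
  calc ∑ u ∈ S, G.numArcs u v ≤ ∑ u : {v : V // v ≠ r}, G.numArcs u v :=
        Finset.sum_le_univ_sum_of_nonneg (by simp)
    _ = ∑ u ∈ Finset.univ.erase r, G.numArcs u v :=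
        (Finset.sum_subtype (Finset.univ.erase r) (by simp) (fun u => G.numArcs u v)).symm
    _ ≤ _ := Finset.sum_le_univ_sum_of_nonneg (by simp)

theorem IsEulerian.isBurnable_of_outDegree_le {G : MultiDigraph V A} (hG : G.IsEulerian) {r : V}
    {c : Config r} (hc : ∀ v : {v : V // v ≠ r}, G.outDegree v ≤ c v) : G.IsBurnable c := by
  rintro S ⟨v, hv⟩
  exact ⟨v, hv, (hG.sum_numArcs_le S v).trans (hc v)⟩

/-- Firing `w` preserves the burning condition: a set containing `w` and other vertices gains, at
each other vertex, the chips sent there by `w`. -/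
theorem IsBurnable.step {G : MultiDigraph V A} {r : V} {c c' : Config r} (h : G.IsBurnable c)
    (hs : G.Step c c') : G.IsBurnable c' := by
  obtain ⟨w, hw, rfl⟩ := hs
  intro S hS
  by_cases hwS : w ∈ S
  · rcases (S.erase w).eq_empty_or_nonempty with h0 | h0
    · obtain rfl : S = {w} := by
        rw [← Finset.insert_erase hwS, h0, insert_empty_eq]
      exact ⟨w, by simp, by simp [fire]⟩
    · obtain ⟨v, hv, hle⟩ := h _ h0
      obtain ⟨hvw, hvS⟩ := Finset.mem_erase.1 hv
      refine ⟨v, hvS, ?_⟩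
      rw [← Finset.add_sum_erase _ _ hwS]
      simp only [fire, hvw, if_false]
      omega
  · obtain ⟨v, hv, hle⟩ := h _ hS
    have hvw : v ≠ w := by rintro rfl; exact hwS hv
    refine ⟨v, hv, ?_⟩
    simp only [fire, hvw, if_false]
    omega

theorem IsBurnable.reach {G : MultiDigraph V A} {r : V} {c c' : Config r} (h : G.IsBurnable c)
    (hs : Relation.ReflTransGen G.Step c c') : G.IsBurnable c' := by
  induction hs with
  | refl => exact h
  | tail _ hs ih => exact ih.step hs

theorem exists_netChips_of_reach {G : MultiDigraph V A} {r : V} {c c' : Config r}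
    (hs : Relation.ReflTransGen G.Step c c') :
    ∃ x : V → ℤ, ∀ v : {v : V // v ≠ r}, (c' v : ℤ) = c v + G.netChips x v := by
  induction hs with
  | refl => exact ⟨0, fun v => by simp [netChips_zero]⟩
  | @tail b d _ hs ih =>
    obtain ⟨x, hx⟩ := ih
    obtain ⟨w, hw, rfl⟩ := hs
    refine ⟨x + Pi.single (w : V) 1, fun v => ?_⟩
    rw [netChips_add, netChips_single, ← add_assoc, ← hx v]
    have := hw.1
    rcases eq_or_ne v w with rfl | hvw
    · simp only [fire, if_true]
      push_cast [Nat.cast_sub this]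
      ring
    · have : (v : V) ≠ w := fun h => hvw (Subtype.ext h)
      simp [fire, hvw, this]

theorem IsEulerian.exists_stabilizesTo {G : MultiDigraph V A} (hG : G.IsEulerian) {r : V}
    (c : Config r) : ∃ c', G.StabilizesTo c c' := by
  obtain ⟨h, hh⟩ := hG.exists_potential r
  induction hn : ∑ v, c v * h v using Nat.strong_induction_on generalizing c with
  | _ n ih =>
    by_cases hst : G.Stable c
    · exact ⟨c, .refl, hst⟩
    simp only [Stable, not_forall, not_not] at hst
    obtain ⟨w, hw⟩ := hst
    have key : ∑ v, G.fire c w v * h v + G.outDegree w * h w =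
        ∑ v, c v * h v + ∑ v : {v : V // v ≠ r}, G.numArcs w v * h v := by
      have : (G.outDegree w * h w) = ∑ v, (if v = w then G.outDegree w * h w else 0) := by simp
      rw [this, ← Finset.sum_add_distrib, ← Finset.sum_add_distrib]
      refine Finset.sum_congr rfl fun v _ => ?_
      rcases eq_or_ne v w with rfl | hvw
      · obtain ⟨k, hk⟩ := Nat.exists_eq_add_of_le hw.1
        simp only [fire, if_true, hk, Nat.add_sub_cancel_left]
        ring
      · simp only [fire, hvw, if_false, Nat.sub_zero]
        ring
    obtain ⟨c', hc', hs⟩ := ih _ (by have := hh w; omega) (G.fire c w) rfl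
    exact ⟨c', .head ⟨w, hw, rfl⟩ hc', hs⟩

/-- Each class of the reduced Laplacian lattice contains at most one stable configuration with the
burning condition. -/
theorem IsEulerian.eq_of_isBurnable {G : MultiDigraph V A} (hG : G.IsEulerian) {r : V}
    {c c' : Config r} (hc : G.IsBurnable c) (hc' : G.IsBurnable c') (hs : G.Stable c)
    (hs' : G.Stable c') {x : V → ℤ}
    (hx : ∀ v : {v : V // v ≠ r}, (c' v : ℤ) = c v + G.netChips x v) : c = c' := by
  -- the least value of the firing vector is taken at the sink
  have key : ∀ {c c' : Config r} {x : V → ℤ}, G.IsBurnable c → G.Stable c' →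
      (∀ v : {v : V // v ≠ r}, (c' v : ℤ) = c v + G.netChips x v) → ∀ v, x r ≤ x v := by
    intro c c' x hc hs' hx v
    obtain ⟨m, -, hm⟩ := Finset.exists_min_image Finset.univ x ⟨r, Finset.mem_univ r⟩
    by_contra! hlt
    have hrm : x m < x r := (hm v (Finset.mem_univ v)).trans_lt hlt
    have hmr : m ≠ r := by rintro rfl; omega
    obtain ⟨w, hw, hle⟩ := hc {u | x u = x m} ⟨⟨m, hmr⟩, by simp⟩
    simp only [Finset.mem_filter, Finset.mem_univ, true_and] at hw
    have hsum : ∑ u ∈ ({u | x u = x m} : Finset {v : V // v ≠ r}), G.numArcs u w =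
        ∑ u ∈ ({u | x u = x m} : Finset V), G.numArcs u w := by
      rw [Finset.sum_filter, Finset.sum_filter]
      exact sum_subtype_ne r (fun u => if x u = x m then G.numArcs u w else 0)
        (by simp [hrm.ne'])
    have h1 := hG.outDegree_le_of_argmin (x := x) (S := {u | x u = x m}) (v := w) (d := c w)
      (fun u hu => by
        have := hm u (Finset.mem_univ u)
        simp only [Finset.mem_filter, Finset.mem_univ, true_and] at hu
        omega)
      (fun u hu => by
        simp only [Finset.mem_filter, Finset.mem_univ, true_and] at hu
        omega)
      (by rw [← hsum]; exact_mod_cast hle)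
    rw [← hx w] at h1
    have := (hG.stable_iff c').1 hs' w
    omega
  have h1 := key hc hs' hx
  have h2 := key (x := -x) hc' hs (fun v => by rw [hx v, netChips_neg]; ring)
  ext v
  have h3 : G.netChips x v = 0 := by
    rw [hG.netChips_eq]
    refine Finset.sum_eq_zero fun u _ => ?_
    have a1 := h1 u
    have a2 := h2 u
    have a3 := h1 v
    have a4 := h2 v
    simp only [Pi.neg_apply] at a2 a4
    rw [show x u - x v = 0 by omega, zero_mul]
  have := hx v
  omega

/-- Each class of the reduced Laplacian lattice contains arbitrarily large configurations. -/
theorem IsEulerian.exists_large_config {G : MultiDigraph V A} (hG : G.IsEulerian) (r : V)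
    (D : V → ℤ) (d : V → ℕ) :
    ∃ (e : Config r) (x : V → ℤ),
      ∀ v : {v : V // v ≠ r}, d v ≤ e v ∧ (e v : ℤ) = D v + G.netChips x v := by
  obtain ⟨x, M, hM, hx⟩ := hG.exists_netChips_pos r
  set k : ℤ := ∑ v, (|D v| + d v) with hk
  have hk' : ∀ v, |D v| + d v ≤ k := fun v =>
    Finset.single_le_sum (f := fun v => |D v| + (d v : ℤ)) (fun v _ => by positivity)
      (Finset.mem_univ v)
  have hle : ∀ v : {v : V // v ≠ r}, (d v : ℤ) ≤ D v + G.netChips (k • x) v := by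
    intro v
    rw [netChips_smul, hx v v.2]
    have h1 := hk' v
    have h2 := neg_abs_le (D v)
    have h3 := abs_nonneg (D v)
    have : k ≤ k * M := le_mul_of_one_le_right (by omega) hM
    omega
  refine ⟨fun v => (D v + G.netChips (k • x) v).toNat, k • x, fun v => ?_⟩
  have := hle v
  beta_reduce
  constructor <;> omega

/-- The chip distribution on all vertices, with `N` chips in total, that extends `c`; the sink may
hold a negative number of chips. -/
def extend {r : V} (N : ℤ) (c : Config r) (v : V) : ℤ :=
  if h : v ≠ r then c ⟨v, h⟩ else N - ∑ u, (c u : ℤ)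

theorem extend_coe {r : V} (N : ℤ) (c : Config r) (v : {v : V // v ≠ r}) :
    extend N c v = c v := by
  simp [extend, v.2]

theorem extend_sink {r : V} (N : ℤ) (c : Config r) :
    extend N c r = N - ∑ u, (c u : ℤ) := by
  simp [extend]

theorem sum_extend {r : V} (N : ℤ) (c : Config r) : ∑ v, extend N c v = N := by
  rw [← Finset.add_sum_erase _ _ (Finset.mem_univ r), extend_sink,
    Finset.sum_subtype (Finset.univ.erase r) (p := fun v => v ≠ r) (by simp) (extend N c)]
  simp only [extend_coe]
  ring

theorem IsEulerian.exists_burnable_representative {G : MultiDigraph V A} (hG : G.IsEulerian)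
    (r : V) (D : V → ℤ) :
    ∃ c : Config r, G.Stable c ∧ G.IsBurnable c ∧
      ∃ x : V → ℤ, ∀ v, extend (∑ v, D v) c v = D v + G.netChips x v := by
  obtain ⟨e, x, he⟩ := hG.exists_large_config r D G.outDegree
  obtain ⟨c, hc, hst⟩ := hG.exists_stabilizesTo e
  obtain ⟨y, hy⟩ := exists_netChips_of_reach hc
  have hoff : ∀ v : {v : V // v ≠ r}, (c v : ℤ) = D v + G.netChips (x + y) v := fun v => by
    rw [hy v, (he v).2, netChips_add]
    ring
  refine ⟨c, hst, (hG.isBurnable_of_outDegree_le (c := e) fun v => (he v).1).reach hc,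
    x + y, fun v => ?_⟩
  by_cases hv : v = r
  · -- both sides have the same total number of chips
    subst hv
    have h1 := sum_extend (r := v) (∑ v, D v) c
    have h2 : ∑ u, (D u + G.netChips (x + y) u) = ∑ u, D u := by
      rw [Finset.sum_add_distrib, sum_netChips, add_zero]
    rw [← Finset.add_sum_erase _ _ (Finset.mem_univ v)] at h1 h2
    have h3 : ∑ u ∈ Finset.univ.erase v, extend (∑ v, D v) c u =
        ∑ u ∈ Finset.univ.erase v, (D u + G.netChips (x + y) u) :=
      Finset.sum_congr rfl fun u hu => by
        rw [← hoff ⟨u, (Finset.mem_erase.1 hu).1⟩, ← extend_coe]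
    omega
  · rw [← hoff ⟨v, hv⟩, ← extend_coe]

/-- Dhar's criterion for Eulerian digraphs. -/
theorem IsEulerian.recurrent_iff {G : MultiDigraph V A} (hG : G.IsEulerian) {r : V}
    (c : Config r) : G.Recurrent r c ↔ G.Stable c ∧ G.IsBurnable c := by
  constructor
  · rintro ⟨hst, h⟩
    obtain ⟨d', hd'⟩ := h fun v => G.outDegree v
    exact ⟨hst, (hG.isBurnable_of_outDegree_le fun v => Nat.le_add_right _ _).reach hd'.1⟩
  · rintro ⟨hst, hb⟩
    refine ⟨hst, fun d => ?_⟩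
    -- a large configuration equivalent to `c` dominates `d` and stabilizes to `c`
    obtain ⟨e, x, he⟩ := hG.exists_large_config r (extend 0 c)
      (fun v => G.outDegree v + (if h : v ≠ r then d ⟨v, h⟩ else 0))
    obtain ⟨c₂, hc₂, hst₂⟩ := hG.exists_stabilizesTo e
    obtain ⟨y, hy⟩ := exists_netChips_of_reach hc₂
    have hle : ∀ v : {v : V // v ≠ r}, G.outDegree v + d v ≤ e v := fun v => by
      have := (he v).1
      simpa [v.2] using this
    have hb₂ : G.IsBurnable c₂ := (hG.isBurnable_of_outDegree_le fun v =>
      (Nat.le_add_right _ _).trans (hle v)).reach hc₂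
    obtain rfl : c = c₂ := hG.eq_of_isBurnable (x := x + y) hb hb₂ hst hst₂ fun v => by
      rw [hy v, (he v).2, extend_coe, netChips_add]
      ring
    refine ⟨fun v => e v - d v, ?_⟩
    have : (d + fun v => e v - d v) = e := by
      ext v
      have := hle v
      simp only [Pi.add_apply]
      omega
    rw [this]
    exact ⟨hc₂, hst⟩

theorem IsEulerian.finite_recurrent {G : MultiDigraph V A} (hG : G.IsEulerian) (r : V) :
    {c : Config r | G.Recurrent r c}.Finite := by
  refine (Set.Finite.pi' (t := fun v : {v : V // v ≠ r} => Set.Iio (G.outDegree v))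
    fun v => Set.finite_Iio _).subset fun c hc => ?_
  exact fun v => (hG.stable_iff c).1 hc.1 v

/-! ### Independence of the sink -/

/-- If `c` is recurrent and the sink holds at least as many chips as it has outgoing arcs, then no
distribution equivalent to `c` is stable at every vertex. -/
theorem IsEulerian.exists_outDegree_le {G : MultiDigraph V A} (hG : G.IsEulerian) {r : V}
    {c : Config r} (hc : G.IsBurnable c) {N : ℤ} (hN : G.confSum r c ≤ N) (x : V → ℤ) :
    ∃ v, (G.outDegree v : ℤ) ≤ extend N c v + G.netChips x v := by
  obtain ⟨m, -, hm⟩ := Finset.exists_min_image Finset.univ x ⟨r, Finset.mem_univ r⟩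
  have hS : ∀ w, x w = x m → ∀ u, u ∉ ({u | x u = x m} : Finset V) → x w < x u := by
    intro w hw u hu
    have := hm u (Finset.mem_univ u)
    simp only [Finset.mem_filter, Finset.mem_univ, true_and] at hu
    omega
  have hS' : ∀ w, x w = x m → ∀ u ∈ ({u | x u = x m} : Finset V), x u = x w := by
    intro w hw u hu
    simp only [Finset.mem_filter, Finset.mem_univ, true_and] at hu
    omega
  by_cases hr : x r = x m
  · refine ⟨r, hG.outDegree_le_of_argmin (hS r hr) (hS' r hr) ?_⟩
    rw [extend_sink]
    have h1 : ∑ u ∈ ({u | x u = x m} : Finset V), G.numArcs u r ≤ G.outDegree r := by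
      rw [← hG.sum_numArcs_left r]
      exact Finset.sum_le_univ_sum_of_nonneg (by simp)
    rw [confSum] at hN
    push_cast at hN
    omega
  · have hmr : m ≠ r := by rintro rfl; exact hr rfl
    obtain ⟨w, hw, hle⟩ := hc {u | x u = x m} ⟨⟨m, hmr⟩, by simp⟩
    simp only [Finset.mem_filter, Finset.mem_univ, true_and] at hw
    refine ⟨w, hG.outDegree_le_of_argmin (hS w hw) (hS' w hw) ?_⟩
    rw [extend_coe, Finset.sum_filter]
    rw [Finset.sum_filter] at hle
    rw [← sum_subtype_ne r (fun u => if x u = x m then G.numArcs u w else 0) (by simp [hr])]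
    exact_mod_cast hle

/-- The recurrent configurations with sink `r`. -/
noncomputable def IsEulerian.recurrentFinset {G : MultiDigraph V A} (hG : G.IsEulerian) (r : V) :
    Finset (Config r) :=
  (hG.finite_recurrent r).toFinset

theorem IsEulerian.mem_recurrentFinset {G : MultiDigraph V A} (hG : G.IsEulerian) {r : V}
    {c : Config r} : c ∈ hG.recurrentFinset r ↔ G.Stable c ∧ G.IsBurnable c := by
  rw [recurrentFinset, Set.Finite.mem_toFinset, Set.mem_ofPred_eq, hG.recurrent_iff]

/-- The recurrent configurations of `confSum` at most `N` correspond to the Laplacian classes of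
degree `N` without a distribution stable at every vertex, a condition that mentions no sink. -/
theorem IsEulerian.card_confSum_le_mono {G : MultiDigraph V A} (hG : G.IsEulerian) (r t : V)
    (N : ℕ) : #{c ∈ hG.recurrentFinset r | G.confSum r c ≤ N} ≤
      #{c ∈ hG.recurrentFinset t | G.confSum t c ≤ N} := by
  refine Finset.card_le_card_of_forall_subsingleton
    (fun c c' => ∃ x : V → ℤ, ∀ v, extend N c' v = extend N c v + G.netChips x v) ?_ ?_
  · intro c hc
    obtain ⟨hc, hN⟩ := Finset.mem_filter.1 hc
    obtain ⟨hst, hb⟩ := hG.mem_recurrentFinset.1 hc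
    obtain ⟨c', hst', hb', x, hx⟩ := hG.exists_burnable_representative t (extend N c)
    rw [sum_extend] at hx
    refine ⟨c', Finset.mem_filter.2 ⟨hG.mem_recurrentFinset.2 ⟨hst', hb'⟩, ?_⟩, x, hx⟩
    obtain ⟨v, hv⟩ := hG.exists_outDegree_le hb (N := N) (by exact_mod_cast hN) x
    rw [← hx] at hv
    by_cases hvt : v = t
    · subst hvt
      rw [extend_sink] at hv
      rw [confSum]
      zify
      omega
    · have h1 := (hG.stable_iff c').1 hst' ⟨v, hvt⟩
      have h2 := extend_coe N c' ⟨v, hvt⟩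
      simp only at h1 h2
      omega
  · rintro c' - c₁ ⟨hc₁, x₁, hx₁⟩ c₂ ⟨hc₂, x₂, hx₂⟩
    obtain ⟨hst₁, hb₁⟩ := hG.mem_recurrentFinset.1 (Finset.mem_filter.1 hc₁).1
    obtain ⟨hst₂, hb₂⟩ := hG.mem_recurrentFinset.1 (Finset.mem_filter.1 hc₂).1
    refine hG.eq_of_isBurnable hb₁ hb₂ hst₁ hst₂ (x := x₁ + -x₂) fun v => ?_
    have h1 := hx₁ v
    have h2 := hx₂ v
    rw [extend_coe _ c₁] at h1
    rw [extend_coe _ c₂] at h2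
    rw [netChips_add, netChips_neg]
    omega

theorem IsEulerian.card_confSum_le {G : MultiDigraph V A} (hG : G.IsEulerian) (r t : V) (N : ℕ) :
    #{c ∈ hG.recurrentFinset r | G.confSum r c ≤ N} =
      #{c ∈ hG.recurrentFinset t | G.confSum t c ≤ N} :=
  (hG.card_confSum_le_mono r t N).antisymm (hG.card_confSum_le_mono t r N)

theorem card_filter_le_succ {α : Type*} (s : Finset α) (f : α → ℕ) (n : ℕ) :
    #{a ∈ s | f a ≤ n + 1} = #{a ∈ s | f a ≤ n} + #{a ∈ s | f a = n + 1} := by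
  classical
  rw [← Finset.card_union_of_disjoint, ← Finset.filter_or]
  · simp only [Nat.le_succ_iff_eq_or_le, or_comm]
  · exact Finset.disjoint_filter.2 fun a _ h1 h2 => by omega

theorem IsEulerian.map_confSum_eq {G : MultiDigraph V A} (hG : G.IsEulerian) (r t : V) :
    (hG.recurrentFinset r).val.map (G.confSum r) =
      (hG.recurrentFinset t).val.map (G.confSum t) := by
  ext n
  rw [Multiset.count_map, Multiset.count_map]
  suffices #{c ∈ hG.recurrentFinset r | G.confSum r c = n} =
      #{c ∈ hG.recurrentFinset t | G.confSum t c = n} by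
    simp only [eq_comm (a := n)]
    exact this
  cases n with
  | zero => simpa only [Nat.le_zero] using hG.card_confSum_le r t 0
  | succ n =>
    have h1 := card_filter_le_succ (hG.recurrentFinset r) (G.confSum r) n
    have h2 := card_filter_le_succ (hG.recurrentFinset t) (G.confSum t) n
    have h3 := hG.card_confSum_le r t n
    have h4 := hG.card_confSum_le r t (n + 1)
    omega

/-- The generating function of `confSum` over the recurrent configurations does not depend on the
sink. -/
theorem IsEulerian.sum_pow_confSum_eq {R : Type*} [CommSemiring R] {G : MultiDigraph V A}
    (hG : G.IsEulerian) (r t : V) (y : R) :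
    ∑ c ∈ hG.recurrentFinset r, y ^ G.confSum r c =
      ∑ c ∈ hG.recurrentFinset t, y ^ G.confSum t c := by
  have := congrArg (fun m : Multiset ℕ => (m.map (y ^ ·)).sum) (hG.map_confSum_eq r t)
  simp only [Multiset.map_map] at this
  exact this

theorem IsEulerian.tutte_eq {G : MultiDigraph V A} (hG : G.IsEulerian) (r : V) :
    G.tutte r = (RatFunc.X : RatFunc ℚ) ^ (-(G.kappa r : ℤ)) *
      ∑ c ∈ hG.recurrentFinset r, (RatFunc.X : RatFunc ℚ) ^ G.confSum r c := by
  rw [tutte, finsum_mem_eq_finite_toFinset_sum _ (hG.finite_recurrent r), Finset.mul_sum]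
  refine Finset.sum_congr rfl fun c _ => ?_
  rw [level, sub_eq_neg_add, zpow_add₀ RatFunc.X_ne_zero, zpow_natCast]

end Game

/-! ### Contractions and their recurrent configurations -/

section Contraction

variable {V V' A : Type*} [Fintype V] [DecidableEq V] [Fintype V'] [DecidableEq V'] [Fintype A]

/-- `H` arises from `G` by collapsing the vertex set `U` to the vertex `r` by means of the vertex
map `π`; the arcs are kept. Both `G.contract U` and, for a one-element set `U`, the digraph `G`
itself are of this form. -/
structure IsContraction (G : MultiDigraph V A) (H : MultiDigraph V' A) (U : Finset V) (π : V → V')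
    (r : V') : Prop where
  tail_eq : ∀ e, H.tail e = π (G.tail e)
  head_eq : ∀ e, H.head e = π (G.head e)
  surjective : Function.Surjective π
  map_eq_iff : ∀ v, π v = r ↔ v ∈ U
  injOn : ∀ u v, u ∉ U → π u = π v → u = v

theorem isContraction_id (G : MultiDigraph V A) (s : V) : G.IsContraction G {s} id s where
  tail_eq _ := rfl
  head_eq _ := rfl
  surjective := Function.surjective_id
  map_eq_iff v := by simp
  injOn _ _ _ h := h

theorem isContraction_contract (G : MultiDigraph V A) {U : Finset V} (hU : U.Nonempty) :
    G.IsContraction (G.contract U) U (contractMap U) none where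
  tail_eq _ := rfl
  head_eq _ := rfl
  surjective := by
    rintro (_ | ⟨v, hv⟩)
    · obtain ⟨u, hu⟩ := hU
      exact ⟨u, by simp [contractMap, hu]⟩
    · exact ⟨v, by simp [contractMap, hv]⟩
  map_eq_iff v := by simp [contractMap]
  injOn u v hu h := by
    by_cases hv : v ∈ U <;> simp_all [contractMap]

variable {G : MultiDigraph V A} {H : MultiDigraph V' A} {U : Finset V} {π : V → V'} {r : V'}

theorem IsContraction.outDegree_eq (h : G.IsContraction H U π r) (w : V') :
    H.outDegree w = ∑ v with π v = w, G.outDegree v := by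
  rw [sum_outDegree, outDegree]
  simp [h.tail_eq]

theorem IsContraction.inDegree_eq (h : G.IsContraction H U π r) (w : V') :
    H.inDegree w = ∑ v with π v = w, G.inDegree v := by
  rw [sum_inDegree, inDegree]
  simp [h.head_eq]

theorem IsContraction.outDegree_map (h : G.IsContraction H U π r) {v : V} (hv : v ∉ U) :
    H.outDegree (π v) = G.outDegree v := by
  rw [h.outDegree_eq, show ({u | π u = π v} : Finset V) = {v} by
    ext u
    simp only [Finset.mem_filter, Finset.mem_univ, true_and, Finset.mem_singleton]
    exact ⟨fun e => (h.injOn v u hv e.symm).symm, fun e => by rw [e]⟩, Finset.sum_singleton]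

theorem IsContraction.outDegree_sink (h : G.IsContraction H U π r) :
    H.outDegree r = ∑ v ∈ U, G.outDegree v := by
  rw [h.outDegree_eq]
  simp [h.map_eq_iff]

theorem IsContraction.numArcs_map (h : G.IsContraction H U π r) {u v : V} (hu : u ∉ U)
    (hv : v ∉ U) : H.numArcs (π u) (π v) = G.numArcs u v := by
  unfold numArcs
  congr 1
  ext e
  simp only [Finset.mem_filter, Finset.mem_univ, true_and, h.tail_eq, h.head_eq]
  exact ⟨fun e => ⟨(h.injOn _ _ hu e.1.symm).symm, (h.injOn _ _ hv e.2.symm).symm⟩,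
    fun e => by rw [e.1, e.2]; exact ⟨rfl, rfl⟩⟩

theorem IsContraction.isEulerian (h : G.IsContraction H U π r) (hG : G.IsEulerian) :
    H.IsEulerian := by
  refine ⟨⟨⟨r⟩, fun u v => ?_⟩, fun v => ?_⟩
  · obtain ⟨a, rfl⟩ := h.surjective u
    obtain ⟨b, rfl⟩ := h.surjective v
    have := hG.1.2 a b
    induction this with
    | rel a b hab =>
      obtain ⟨e, rfl, rfl⟩ := hab
      exact .rel _ _ ⟨e, h.tail_eq e, h.head_eq e⟩
    | refl => exact .refl _
    | symm _ _ _ ih => exact ih.symm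
    | trans _ _ _ _ _ ih1 ih2 => exact ih1.trans _ _ _ ih2
  · rw [h.inDegree_eq, h.outDegree_eq]
    exact Finset.sum_congr rfl fun v _ => hG.2 v

/-- The recurrent configurations of the digraph obtained from `G` by collapsing `U` to the sink,
written as functions on the vertices of `G` that vanish on `U`. -/
def recurrentRel (G : MultiDigraph V A) (U : Finset V) : Finset (V → ℕ) :=
  {c ∈ Fintype.piFinset (fun v => if v ∈ U then {0} else Finset.range (G.outDegree v)) |
    ∀ S : Finset V, S.Nonempty → Disjoint S U → ∃ v ∈ S, ∑ u ∈ S, G.numArcs u v ≤ c v}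

theorem mem_recurrentRel {c : V → ℕ} : c ∈ G.recurrentRel U ↔
    ((∀ v ∈ U, c v = 0) ∧ ∀ v ∉ U, c v < G.outDegree v) ∧
      ∀ S : Finset V, S.Nonempty → Disjoint S U → ∃ v ∈ S, ∑ u ∈ S, G.numArcs u v ≤ c v := by
  rw [recurrentRel, Finset.mem_filter, Fintype.mem_piFinset, ← forall_and]
  refine and_congr_left' (forall_congr' fun v => ?_)
  by_cases hv : v ∈ U <;> simp [hv]

/-- The vertices outside `U` are those of the contraction other than the sink. -/
noncomputable def IsContraction.equiv (h : G.IsContraction H U π r) :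
    {v : V // v ∉ U} ≃ {w : V' // w ≠ r} :=
  Equiv.ofBijective (fun v => ⟨π v, fun e => v.2 ((h.map_eq_iff v).1 e)⟩) <| by
    constructor
    · intro u v e
      exact Subtype.ext (h.injOn u v u.2 (congrArg Subtype.val e))
    · rintro ⟨w, hw⟩
      obtain ⟨v, rfl⟩ := h.surjective w
      exact ⟨⟨v, fun hv => hw ((h.map_eq_iff v).2 hv)⟩, rfl⟩

theorem IsContraction.coe_equiv (h : G.IsContraction H U π r) (v : {v : V // v ∉ U}) :
    (h.equiv v : V') = π v := rfl

/-- A configuration of the contraction as a function on the vertices of `G`, zero on `U`. -/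
noncomputable def IsContraction.pullback (h : G.IsContraction H U π r) (c : Config r) (v : V) : ℕ :=
  if hv : v ∉ U then c (h.equiv ⟨v, hv⟩) else 0

theorem IsContraction.pullback_coe (h : G.IsContraction H U π r) (c : Config r)
    (v : {v : V // v ∉ U}) : h.pullback c v = c (h.equiv v) := by
  simp [pullback, v.2]

theorem IsContraction.pullback_of_mem (h : G.IsContraction H U π r) (c : Config r) {v : V}
    (hv : v ∈ U) : h.pullback c v = 0 := by
  simp [pullback, hv]

theorem IsContraction.pullback_mem_iff (h : G.IsContraction H U π r) (hH : H.IsEulerian)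
    (c : Config r) : h.pullback c ∈ G.recurrentRel U ↔ H.Stable c ∧ H.IsBurnable c := by
  rw [mem_recurrentRel, hH.stable_iff]
  refine and_congr ⟨fun hc w => ?_, fun hc => ⟨fun v hv => h.pullback_of_mem c hv, fun v hv => ?_⟩⟩
    ⟨fun hc T hT => ?_, fun hc S hS hd => ?_⟩
  · obtain ⟨v, rfl⟩ := h.equiv.surjective w
    rw [← h.pullback_coe c v, h.coe_equiv, h.outDegree_map v.2]
    exact hc.2 v v.2
  · have := hc (h.equiv ⟨v, hv⟩)
    rwa [← h.pullback_coe c ⟨v, hv⟩, h.coe_equiv, h.outDegree_map hv] at this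
  · obtain ⟨v, hv, hle⟩ := hc
      (T.map (h.equiv.symm.toEmbedding.trans (Function.Embedding.subtype _)))
      (by simpa using hT) (by
        rw [Finset.disjoint_left]
        intro v hv
        obtain ⟨w, -, rfl⟩ := Finset.mem_map.1 hv
        exact (h.equiv.symm w).2)
    obtain ⟨w, hw, rfl⟩ := Finset.mem_map.1 hv
    obtain ⟨v, rfl⟩ := h.equiv.surjective w
    refine ⟨_, hw, ?_⟩
    rw [Finset.sum_map] at hle
    simp only [Function.Embedding.trans_apply, Equiv.coe_toEmbedding, Equiv.symm_apply_apply,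
      Function.Embedding.subtype_apply, h.pullback_coe] at hle
    refine le_trans (le_of_eq (Finset.sum_congr rfl fun u _ => ?_)) hle
    obtain ⟨u, rfl⟩ := h.equiv.surjective u
    rw [h.coe_equiv, h.coe_equiv, h.numArcs_map u.2 v.2, Equiv.symm_apply_apply]
  · have hSU : ∀ v ∈ S, v ∉ U := fun _ hv => Finset.disjoint_left.1 hd hv
    obtain ⟨w, hw, hle⟩ := hc ((S.subtype (· ∉ U)).map h.equiv.toEmbedding) (by
      obtain ⟨v, hv⟩ := hS
      exact ⟨h.equiv ⟨v, hSU v hv⟩, by simpa using hv⟩)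
    obtain ⟨v, hv, rfl⟩ := Finset.mem_map.1 hw
    refine ⟨v, Finset.mem_subtype.1 hv, ?_⟩
    rw [h.pullback_coe, ← Finset.sum_subtype_of_mem (fun u => G.numArcs u v) hSU]
    rw [Finset.sum_map] at hle
    refine le_trans (le_of_eq (Finset.sum_congr rfl fun u _ => ?_)) hle
    simp only [Equiv.coe_toEmbedding, h.coe_equiv]
    rw [h.numArcs_map u.2 v.2]

theorem IsContraction.sum_pullback (h : G.IsContraction H U π r) (c : Config r) :
    ∑ v, h.pullback c v = ∑ w, c w := by
  rw [← Finset.sum_compl_add_sum U, Finset.sum_eq_zero (s := U) fun v hv => h.pullback_of_mem c hv,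
    add_zero, Finset.sum_subtype Uᶜ (p := (· ∉ U)) (by simp), ← Equiv.sum_comp h.equiv]
  exact Finset.sum_congr rfl fun v _ => h.pullback_coe c v

theorem IsContraction.sum_pow_confSum {R : Type*} [CommSemiring R] (h : G.IsContraction H U π r)
    (hH : H.IsEulerian) (y : R) :
    ∑ c ∈ hH.recurrentFinset r, y ^ H.confSum r c =
      y ^ (∑ v ∈ U, G.outDegree v) * ∑ c ∈ G.recurrentRel U, y ^ ∑ v, c v := by
  rw [Finset.mul_sum]
  refine Finset.sum_nbij' (fun c => h.pullback c) (fun c w => c (h.equiv.symm w)) ?_ ?_ ?_ ?_ ?_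
  · intro c hc
    exact (h.pullback_mem_iff hH c).2 (hH.mem_recurrentFinset.1 hc)
  · intro c hc
    refine hH.mem_recurrentFinset.2 ((h.pullback_mem_iff hH _).1 ?_)
    convert hc using 1
    ext v
    by_cases hv : v ∈ U
    · rw [h.pullback_of_mem _ hv, (mem_recurrentRel.1 hc).1.1 v hv]
    · simp [pullback, hv]
  · intro c _
    ext w
    simp [h.pullback_coe]
  · intro c hc
    ext v
    by_cases hv : v ∈ U
    · rw [h.pullback_of_mem _ hv, (mem_recurrentRel.1 hc).1.1 v hv]
    · simp [pullback, hv]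
  · intro c _
    rw [h.sum_pullback, ← pow_add, confSum, h.outDegree_sink]

end Contraction

/-! ### Sorting recurrent configurations by the vertices that the sink makes unstable -/

section Recursion

variable {V A : Type*} [Fintype V] [DecidableEq V] [Fintype A] {G : MultiDigraph V A}

theorem mem_outNeighbors {s v : V} : v ∈ G.outNeighbors s ↔ v ≠ s ∧ 0 < G.numArcs s v := by
  rw [numArcs_pos_iff]
  simp [outNeighbors]

theorem numArcsTo_eq_sum (G : MultiDigraph V A) (s : V) (W : Finset V) :
    G.numArcsTo s W = ∑ v ∈ W, G.numArcs s v := by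
  unfold numArcsTo numArcs
  rw [Finset.card_eq_sum_card_fiberwise (s := {e : A | G.tail e = s ∧ G.head e ∈ W}) (f := G.head)
    (t := W) (by intro e; simp)]
  refine Finset.sum_congr rfl fun v hv => ?_
  rw [Finset.filter_filter]
  congr 1
  ext e
  simp only [Finset.mem_filter, Finset.mem_univ, true_and]
  exact ⟨fun h => ⟨h.1.1, h.2⟩, fun h => ⟨⟨h.1, h.2 ▸ hv⟩, h.2⟩⟩

theorem IsEulerian.numArcs_le {G : MultiDigraph V A} (hG : G.IsEulerian) (u v : V) :
    G.numArcs u v ≤ G.outDegree v := by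
  rw [← hG.sum_numArcs_left v]
  exact Finset.single_le_sum (f := fun u => G.numArcs u v) (fun _ _ => Nat.zero_le _)
    (Finset.mem_univ u)

/-- The out-neighbours of `s` that become unstable once the sink `s` has fired. -/
def ignited (G : MultiDigraph V A) (s : V) (c : V → ℕ) : Finset V :=
  {v ∈ G.outNeighbors s | G.outDegree v ≤ c v + G.numArcs s v}

theorem IsEulerian.ignited_nonempty (hG : G.IsEulerian) {s : V} (hV : 2 ≤ Fintype.card V)
    {c : V → ℕ} (hc : c ∈ G.recurrentRel {s}) : (G.ignited s c).Nonempty := by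
  obtain ⟨⟨-, hlt⟩, hb⟩ := mem_recurrentRel.1 hc
  have : Nontrivial V := Fintype.one_lt_card_iff_nontrivial.1 hV
  obtain ⟨w, hw⟩ := exists_ne s
  obtain ⟨v, hv, hle⟩ := hb (Finset.univ.erase s) ⟨w, by simpa using hw⟩ (by simp)
  have hvs : v ≠ s := (Finset.mem_erase.1 hv).1
  have h1 := hlt v (by simpa using hvs)
  have h2 := hG.sum_numArcs_left v
  rw [← Finset.add_sum_erase _ _ (Finset.mem_univ s)] at h2
  exact ⟨v, Finset.mem_filter.2 ⟨mem_outNeighbors.2 ⟨hvs, by omega⟩, by omega⟩⟩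

/-- A configuration that ignites all of `W` is recurrent exactly if its restriction to the vertices
outside `W` is recurrent for the contraction of `insert s W`. -/
theorem IsEulerian.mem_recurrentRel_iff_of_ignited (hG : G.IsEulerian) {s : V} {W : Finset V}
    {c c' : V → ℕ} (hcs : c s = 0) (hc's : ∀ v ∈ insert s W, c' v = 0)
    (hcc' : ∀ v ∉ insert s W, c v = c' v)
    (hW : ∀ v ∈ W, c v < G.outDegree v ∧ G.outDegree v ≤ c v + G.numArcs s v) :
    c ∈ G.recurrentRel {s} ↔ c' ∈ G.recurrentRel (insert s W) := by
  rw [mem_recurrentRel, mem_recurrentRel]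
  refine and_congr ⟨fun h => ⟨hc's, fun v hv => ?_⟩, fun h => ⟨by simpa using hcs, fun v hv => ?_⟩⟩
    ⟨fun h S hS hd => ?_, fun h S hS hd => ?_⟩
  · rw [← hcc' v hv]
    exact h.2 v (by simp_all)
  · by_cases hvW : v ∈ W
    · exact (hW v hvW).1
    · have hv' : v ∉ insert s W := by simp_all
      rw [hcc' v hv']
      exact h.2 v hv'
  · obtain ⟨v, hv, hle⟩ := h S hS (hd.mono_right (by simp))
    exact ⟨v, hv, by rwa [← hcc' v (Finset.disjoint_left.1 hd hv)]⟩
  · by_cases hSW : Disjoint S W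
    · have hd' : Disjoint S (insert s W) := by
        rw [Finset.insert_eq, Finset.disjoint_union_right]
        exact ⟨hd, hSW⟩
      obtain ⟨v, hv, hle⟩ := h S hS hd'
      exact ⟨v, hv, by rwa [hcc' v (Finset.disjoint_left.1 hd' hv)]⟩
    · obtain ⟨v, hv, hvW⟩ := Finset.not_disjoint_iff.1 hSW
      refine ⟨v, hv, ?_⟩
      have hsS : s ∉ S := by simpa using hd
      have h1 : G.numArcs s v + ∑ u ∈ S, G.numArcs u v ≤ G.outDegree v := by
        rw [← hG.sum_numArcs_left v, ← Finset.sum_insert (f := fun u => G.numArcs u v) hsS]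
        exact Finset.sum_le_univ_sum_of_nonneg (by simp)
      have := (hW v hvW).2
      omega

theorem IsEulerian.sum_ignited {R : Type*} [CommSemiring R] (hG : G.IsEulerian) {s : V}
    {W : Finset V} (hW : W ⊆ G.outNeighbors s) (y : R) :
    ∑ c ∈ G.recurrentRel {s} with W ⊆ G.ignited s c, y ^ ∑ v, c v =
      (∏ v ∈ W, ∑ k ∈ Finset.Ico (G.outDegree v - G.numArcs s v) (G.outDegree v), y ^ k) *
        ∑ c ∈ G.recurrentRel (insert s W), y ^ ∑ v, c v := by
  have hs : s ∉ W := fun h => (mem_outNeighbors.1 (hW h)).1 rfl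
  set I : V → Finset ℕ := fun v =>
    if v ∈ W then Finset.Ico (G.outDegree v - G.numArcs s v) (G.outDegree v) else {0} with hI
  have hprod : ∏ v ∈ W, ∑ k ∈ Finset.Ico (G.outDegree v - G.numArcs s v) (G.outDegree v), y ^ k =
      ∑ p ∈ Fintype.piFinset I, y ^ ∑ v, p v := by
    simp only [← Finset.prod_pow_eq_pow_sum]
    rw [← Finset.prod_univ_sum, ← Finset.prod_mul_prod_compl W,
      Finset.prod_eq_one (s := Wᶜ) fun v hv => by simp [hI, Finset.mem_compl.1 hv], mul_one]
    exact Finset.prod_congr rfl fun v hv => by simp [hI, hv]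
  have hmemI : ∀ p, p ∈ Fintype.piFinset I ↔
      (∀ v ∈ W, p v < G.outDegree v ∧ G.outDegree v ≤ p v + G.numArcs s v) ∧
        ∀ v ∉ W, p v = 0 := by
    intro p
    rw [Fintype.mem_piFinset, ← forall_and]
    refine forall_congr' fun v => ?_
    by_cases hv : v ∈ W
    · simp only [hI, hv, if_true, Finset.mem_Ico, forall_const, not_true_eq_false, false_implies,
        and_true]
      omega
    · simp [hI, hv]
  have hign : ∀ c, W ⊆ G.ignited s c ↔ ∀ v ∈ W, G.outDegree v ≤ c v + G.numArcs s v := by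
    intro c
    refine forall_congr' fun v => forall_congr' fun hv => ?_
    rw [ignited, Finset.mem_filter, and_iff_right (hW hv)]
  rw [hprod, Finset.sum_mul_sum, ← Finset.sum_product']
  refine Finset.sum_nbij' (fun c => (fun v => if v ∈ W then c v else 0,
    fun v => if v ∈ W then 0 else c v)) (fun p => p.1 + p.2) ?_ ?_ ?_ ?_ ?_
  · intro c hc
    obtain ⟨hc, hcW⟩ := Finset.mem_filter.1 hc
    rw [hign] at hcW
    have hc' := mem_recurrentRel.1 hc
    have hcs : c s = 0 := hc'.1.1 s (by simp)
    have hbound : ∀ v ∈ W, c v < G.outDegree v ∧ G.outDegree v ≤ c v + G.numArcs s v :=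
      fun v hv => ⟨hc'.1.2 v (by rw [Finset.mem_singleton]; rintro rfl; exact hs hv), hcW v hv⟩
    refine Finset.mem_product.2 ⟨(hmemI _).2 ⟨fun v hv => by simpa [hv] using hbound v hv,
      fun v hv => by simp [hv]⟩, ?_⟩
    refine (hG.mem_recurrentRel_iff_of_ignited hcs ?_ ?_ hbound).1 hc
    · intro v hv
      rcases Finset.mem_insert.1 hv with rfl | hv
      · simp [hcs]
      · simp [hv]
    · intro v hv
      have : v ∉ W := fun h => hv (Finset.mem_insert_of_mem h)
      simp [this]
  · rintro ⟨p, c⟩ hpc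
    obtain ⟨hp, hc⟩ := Finset.mem_product.1 hpc
    obtain ⟨hp1, hp0⟩ := (hmemI p).1 hp
    have hc0 : ∀ v ∈ insert s W, c v = 0 := (mem_recurrentRel.1 hc).1.1
    have hcW : ∀ v ∈ W, c v = 0 := fun v hv => hc0 v (Finset.mem_insert_of_mem hv)
    refine Finset.mem_filter.2 ⟨(hG.mem_recurrentRel_iff_of_ignited ?_ hc0 ?_ ?_).2 hc, ?_⟩
    · simp [hp0 s hs, hc0 s (by simp)]
    · intro v hv
      simp [hp0 v fun h => hv (Finset.mem_insert_of_mem h)]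
    · intro v hv
      simpa [hcW v hv] using hp1 v hv
    · rw [hign]
      intro v hv
      simpa [hcW v hv] using (hp1 v hv).2
  · intro c _
    ext v
    by_cases hv : v ∈ W <;> simp [hv]
  · rintro ⟨p, c⟩ hpc
    obtain ⟨hp, hc⟩ := Finset.mem_product.1 hpc
    have hp0 := ((hmemI p).1 hp).2
    have hc0 : ∀ v ∈ insert s W, c v = 0 := (mem_recurrentRel.1 hc).1.1
    ext v
    · by_cases hv : v ∈ W
      · simp [hv, hc0 v (Finset.mem_insert_of_mem hv)]
      · simp [hv, hp0 v hv]
    · by_cases hv : v ∈ W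
      · simp [hv, hc0 v (Finset.mem_insert_of_mem hv)]
      · simp [hv, hp0 v hv]
  · intro c _
    rw [← pow_add, ← Finset.sum_add_distrib]
    congr 1
    exact Finset.sum_congr rfl fun v _ => by by_cases hv : v ∈ W <;> simp [hv]

/-- Inclusion–exclusion over the nonempty sets of ignited vertices. -/
theorem IsEulerian.sum_recurrentRel {R : Type*} [CommRing R] (hG : G.IsEulerian)
    (hV : 2 ≤ Fintype.card V) (s : V) (y : R) :
    ∑ c ∈ G.recurrentRel {s}, y ^ ∑ v, c v =
      ∑ W ∈ (G.outNeighbors s).powerset with W ≠ ∅, (-1) ^ (#W + 1) *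
        ∑ c ∈ G.recurrentRel {s} with W ⊆ G.ignited s c, y ^ ∑ v, c v := by
  simp only [Finset.mul_sum, Finset.sum_filter (s := G.recurrentRel {s})]
  rw [Finset.sum_comm]
  refine Finset.sum_congr rfl fun c hc => ?_
  have hne := hG.ignited_nonempty hV hc
  have hsub : G.ignited s c ⊆ G.outNeighbors s := Finset.filter_subset _ _
  have h1 : ∑ W ∈ (G.ignited s c).powerset, (-1 : R) ^ #W = 0 := by
    have := congrArg (Int.cast : ℤ → R) (Finset.sum_powerset_neg_one_pow_card_of_nonempty hne)
    simpa using this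
  rw [← Finset.add_sum_erase _ _ (Finset.empty_mem_powerset _), Finset.card_empty, pow_zero] at h1
  have h2 : ∑ W ∈ (G.ignited s c).powerset.erase ∅, (-1 : R) ^ (#W + 1) = 1 := by
    simp only [pow_succ, mul_neg, mul_one, Finset.sum_neg_distrib]
    linear_combination -h1
  simp only [mul_ite, mul_zero]
  rw [← Finset.sum_filter, Finset.filter_filter, ← Finset.sum_mul]
  have h3 : ({W ∈ (G.outNeighbors s).powerset | W ≠ ∅ ∧ W ⊆ G.ignited s c} : Finset (Finset V)) =
      (G.ignited s c).powerset.erase ∅ := by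
    ext W
    simp only [Finset.mem_filter, Finset.mem_powerset, Finset.mem_erase]
    exact ⟨fun h => ⟨h.2.1, h.2.2⟩, fun h => ⟨h.2.trans hsub, h.1, h.2⟩⟩
  rw [h3, h2, one_mul]

end Recursion

/-! ### Geometric sums and the contraction formula -/

theorem _root_.RatFunc.one_sub_X_ne_zero : (1 - RatFunc.X : RatFunc ℚ) ≠ 0 := by
  intro h
  have h1 : (algebraMap (Polynomial ℚ) (RatFunc ℚ)) 1 =
      algebraMap (Polynomial ℚ) (RatFunc ℚ) Polynomial.X := by
    rw [map_one, RatFunc.algebraMap_X]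
    exact sub_eq_zero.1 h
  have h2 := congrArg (Polynomial.eval 0) (RatFunc.algebraMap_injective ℚ h1)
  simp at h2

theorem _root_.RatFunc.sum_Ico_X_pow {d n : ℕ} (h : d ≤ n) :
    ∑ k ∈ Finset.Ico (n - d) n, (RatFunc.X : RatFunc ℚ) ^ k =
      RatFunc.X ^ (n - d) * (1 - RatFunc.X ^ d) / (1 - RatFunc.X) := by
  rw [eq_div_iff RatFunc.one_sub_X_ne_zero]
  have := geom_sum_Ico_mul (RatFunc.X : RatFunc ℚ) (Nat.sub_le n d)
  obtain ⟨m, rfl⟩ := Nat.exists_eq_add_of_le' h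
  rw [Nat.add_sub_cancel] at *
  rw [pow_add] at this
  linear_combination -this

end MultiDigraph

/-- The sinks `t` and `r W`, with respect to which the polynomials and the numbers `κ` are computed,
are arbitrary: neither depends on the choice of a sink. -/
theorem proposition9 {V A : Type*} [Fintype V] [DecidableEq V] [Fintype A]
    (G : MultiDigraph V A) (hG : G.IsEulerian) (hV : 2 ≤ Fintype.card V) (s : V)
    (t : V) (r : (W : Finset V) → Option {v : V // v ∉ insert s W}) :
    G.tutte t =
      ∑ W ∈ (G.outNeighbors s).powerset with W ≠ ∅,
        (-1 : RatFunc ℚ) ^ (#W + 1) *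
          (RatFunc.X : RatFunc ℚ) ^
            (((G.contract (insert s W)).kappa (r W) : ℤ) - (G.kappa t : ℤ)
              - (G.numArcsTo s W : ℤ)) *
          (1 / (1 - RatFunc.X) ^ #W) *
          (∏ v ∈ W, (1 - (RatFunc.X : RatFunc ℚ) ^ G.numArcs s v)) *
          (G.contract (insert s W)).tutte (r W) := by
  rw [hG.tutte_eq, hG.sum_pow_confSum_eq t s, (G.isContraction_id s).sum_pow_confSum hG,
    hG.sum_recurrentRel hV, Finset.mul_sum, Finset.mul_sum]
  refine Finset.sum_congr rfl fun W hW => ?_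
  obtain ⟨hWN, -⟩ := Finset.mem_filter.1 hW
  rw [Finset.mem_powerset] at hWN
  have hs : s ∉ W := fun h => (MultiDigraph.mem_outNeighbors.1 (hWN h)).1 rfl
  have hC := G.isContraction_contract (Finset.insert_nonempty s W)
  have hE := hC.isEulerian hG
  rw [hE.tutte_eq, hE.sum_pow_confSum_eq (r W) none, hC.sum_pow_confSum hE, hG.sum_ignited hWN,
    Finset.prod_congr rfl fun v _ => RatFunc.sum_Ico_X_pow (hG.numArcs_le s v),
    Finset.prod_div_distrib, Finset.prod_mul_distrib, Finset.prod_pow_eq_pow_sum, Finset.prod_const,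
    Finset.sum_singleton, Finset.sum_insert hs]
  have hdeg : ∑ v ∈ W, (G.outDegree v - G.numArcs s v) + G.numArcsTo s W =
      ∑ v ∈ W, G.outDegree v := by
    rw [MultiDigraph.numArcsTo_eq_sum, ← Finset.sum_add_distrib]
    exact Finset.sum_congr rfl fun v _ => Nat.sub_add_cancel (hG.numArcs_le s v)
  have hX := RatFunc.X_ne_zero (K := ℚ)
  have hX1 := RatFunc.one_sub_X_ne_zero
  rw [← hdeg, pow_add _ (G.outDegree s), pow_add _ (∑ v ∈ W, _), zpow_sub₀ hX, zpow_sub₀ hX,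
    zpow_neg, zpow_neg, zpow_natCast, zpow_natCast, zpow_natCast]
  field_simp
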